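/- Let $X_1, X_2, \ldots$ be independent random variables, each uniformly distributed on $[0,1]$, and let $f:[0,1]\to[0,1]$ be an increasing bijection. Let $\mu_f = E[f(X_i)]$, which is positive and the same for every $i$. For $t \ge 0$ let $K_f(t)$ be the smallest $k$ such that $\sum_{i=1}^{k} f(X_i) > t$ (with $K_f(t)=\infty$ if there is no such $k$), and let $N_f(t) = E[K_f(t)]$. Put $$c_f = \frac{1}{\mu_f}\int_0^1\int_{f^{-1}(u)}^1 (f(x)-u)\,dx\,du .$$ Then $N_f(t)$ is finite for every $t \ge 0$, and $$N_f(t) = \frac{t+c_f}{\mu_f} + o(1) \qquad (t\to\infty).$$ Moreover $\int_0^1\int_{f^{-1}(u)}^1 (f(x)-u)\,dx\,du = \tfrac12 E[f(X_i)^2]$ for every $i$. -/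

import Mathlib

open MeasureTheory ProbabilityTheory Filter
open scoped unitInterval ENNReal Asymptotics

noncomputable section

/-- The partial sum `f(X₁) + ⋯ + f(X_k)`; the random variable `X_{i+1}` of the mathematical text
is `X i`, so the summation index runs over `0, …, k - 1`. -/
def partialSum {Ω : Type*} (f : I ≃o I) (X : ℕ → Ω → I) (k : ℕ) (ω : Ω) : ℝ :=
  ∑ i ∈ Finset.range k, (f (X i ω) : ℝ)

/-- The smallest `k` such that `f(X₁) + ⋯ + f(X_k) > t`, with value `∞` if there is none. -/
def firstPassage {Ω : Type*} (f : I ≃o I) (X : ℕ → Ω → I) (t : ℝ) (ω : Ω) : ℕ∞ :=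
  ⨅ (k : ℕ) (_ : t < partialSum f X k ω), (k : ℕ∞)

/-- The expected value of the first passage index, as an extended nonnegative number. -/
def expectedPassage {Ω : Type*} [MeasurableSpace Ω] (P : Measure Ω) (f : I ≃o I)
    (X : ℕ → Ω → I) (t : ℝ) : ℝ≥0∞ :=
  ∫⁻ ω, (firstPassage f X t ω : ℝ≥0∞) ∂P

/-- The expected value of `f(X₁)`. -/
def meanValue {Ω : Type*} [MeasurableSpace Ω] (P : Measure Ω) (f : I ≃o I)
    (X : ℕ → Ω → I) : ℝ :=
  ∫ ω, (f (X 0 ω) : ℝ) ∂P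

/-- The double integral `∫₀¹ ∫_{f⁻¹(u)}^1 (f(x) - u) dx du`; the measure on `[0,1]` is Lebesgue
measure. -/
def overshootIntegral (f : I ≃o I) : ℝ :=
  ∫ u : I, ∫ x in Set.Icc (f.symm u) 1, ((f x : ℝ) - (u : ℝ))

/-- The constant `c_f`. -/
def overshootConst {Ω : Type*} [MeasurableSpace Ω] (P : Measure Ω) (f : I ≃o I)
    (X : ℕ → Ω → I) : ℝ :=
  overshootIntegral f / meanValue P f X

end

/-! Let `ν` be the law of `f(X_i)`, with mean `μ`. Conditioning on one summand gives the renewal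
equation `N(t) = 1 + ∫ N(t - y) dν(y)` for `t ≥ 0`, so `r(t) = μ N(t) - t` solves the homogeneous
equation there, with `r(t) = -t` for `t < 0`. The maximum principle `nonpos_of_le_integral_sub`
gives `0 ≤ r ≤ 1` on `[-1, ∞)`.

The integral `∫ ∫_0^y r(t - s) ds dν(y)` does not depend on `t ≥ 0`
(`integral_intervalIntegral_sub_eq`); at `t = 0` it is `Λ = ∫ y²/2 dν`. Along times where `r`
approaches its limsup `M`, `r` is nearly maximal yet an average of earlier values. As `ν` has full
support and `r` falls at most at unit rate, `r` is close to `M` on the whole preceding unit window,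
so `μ M = Λ` (`mean_mul_limsup_eq`). The same for `-r` gives `r → Λ/μ`, which is `c_f` by
`overshootIntegral_eq`. -/

/-- The Laplace transform at `1` of a probability measure on `[0,1]` of full support is less
than one. -/
lemma integral_exp_neg_lt_one (ν : Measure I) [IsProbabilityMeasure ν] [ν.IsOpenPosMeasure] :
    ∫ y : I, Real.exp (-(y : ℝ)) ∂ν < 1 := by
  have hc : Continuous fun y : I => 1 - Real.exp (-(y : ℝ)) := by fun_prop
  have h : 0 < ∫ y : I, (1 - Real.exp (-(y : ℝ))) ∂ν := by
    refine hc.integral_pos_of_hasCompactSupport_nonneg_nonzero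
      (HasCompactSupport.of_compactSpace _) (fun y => ?_) (x := 1) ?_
    · have := y.2.1
      simpa using this
    · have : Real.exp (-1) < 1 := by simp
      simp only [Set.Icc.coe_one]
      linarith
  have hi : Integrable (fun y : I => Real.exp (-(y : ℝ))) ν :=
    Continuous.integrable_of_hasCompactSupport (by fun_prop) (HasCompactSupport.of_compactSpace _)
  rw [integral_sub (integrable_const _) hi] at h
  simpa using h

lemma integral_coe_pos (ν : Measure I) [IsProbabilityMeasure ν] [ν.IsOpenPosMeasure] :
    0 < ∫ y : I, (y : ℝ) ∂ν := by
  have hc : Continuous fun y : I => (y : ℝ) := by fun_prop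
  exact hc.integral_pos_of_hasCompactSupport_nonneg_nonzero
    (HasCompactSupport.of_compactSpace _) (fun y => y.2.1) (x := 1) (by simp)

/-- A maximum principle for subsolutions of the renewal equation of at most exponential growth. -/
lemma nonpos_of_le_integral_sub (ν : Measure I) [IsProbabilityMeasure ν] [ν.IsOpenPosMeasure]
    {v : ℝ → ℝ} {C : ℝ} (hC : 0 ≤ C) (hneg : ∀ t, -1 ≤ t → t < 0 → v t ≤ 0)
    (hgrowth : ∀ t, 0 ≤ t → v t ≤ C * Real.exp t)
    (hint : ∀ t, 0 ≤ t → Integrable (fun y : I => v (t - y)) ν)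
    (hsub : ∀ t, 0 ≤ t → v t ≤ ∫ y : I, v (t - y) ∂ν) {t : ℝ} (ht : -1 ≤ t) : v t ≤ 0 := by
  set q := ∫ y : I, Real.exp (-(y : ℝ)) ∂ν with hq
  have hq0 : 0 ≤ q := integral_nonneg fun y => (Real.exp_pos _).le
  have hq1 : q < 1 := integral_exp_neg_lt_one ν
  -- Averaging `exp (t - y)` over `ν` multiplies `exp t` by `q < 1`, so each use of the subsolution
  -- inequality improves the bound by a factor `q`.
  have key : ∀ n : ℕ, ∀ t, -1 ≤ t → v t ≤ q ^ n * C * Real.exp t := by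
    intro n
    induction n with
    | zero =>
      intro t ht
      rcases lt_or_ge t 0 with h | h
      · exact (hneg t ht h).trans (by positivity)
      · simpa using hgrowth t h
    | succ n ih =>
      intro t ht
      rcases lt_or_ge t 0 with h | h
      · exact (hneg t ht h).trans (by positivity)
      · have hi : Integrable (fun y : I => q ^ n * C * Real.exp (t - y)) ν :=
          Continuous.integrable_of_hasCompactSupport (by fun_prop)
            (HasCompactSupport.of_compactSpace _)
        calc v t ≤ ∫ y : I, v (t - y) ∂ν := hsub t h
          _ ≤ ∫ y : I, q ^ n * C * Real.exp (t - y) ∂ν :=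
            integral_mono (hint t h) hi fun y => ih _ (by have := y.2.2; linarith)
          _ = q ^ (n + 1) * C * Real.exp t := by
            simp_rw [sub_eq_add_neg t, Real.exp_add]
            rw [integral_const_mul, integral_const_mul, ← hq]
            ring
  have hlim : Tendsto (fun n : ℕ => q ^ n * C * Real.exp t) atTop (nhds (0 * C * Real.exp t)) :=
    ((tendsto_pow_atTop_nhds_zero_of_lt_one hq0 hq1).mul_const C).mul_const _
  simpa using ge_of_tendsto' hlim fun n => key n t ht

/-! ### Bounded solutions of the homogeneous renewal equation -/

lemma intervalIntegrable_of_abs_le_one {w : ℝ → ℝ} (hw : Measurable w) (hb : ∀ t, |w t| ≤ 1)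
    (a b : ℝ) : IntervalIntegrable w volume a b :=
  (intervalIntegrable_const (c := (1 : ℝ))).mono_fun hw.aestronglyMeasurable
    (Eventually.of_forall fun t => by simpa using hb t)

lemma integrable_of_abs_le_one {α : Type*} [MeasurableSpace α] {μ : Measure α} [IsFiniteMeasure μ]
    {w : α → ℝ} (hw : Measurable w) (hb : ∀ t, |w t| ≤ 1) : Integrable w μ :=
  .of_bound hw.aestronglyMeasurable 1 (Eventually.of_forall fun t => by simpa using hb t)

/-- For a bounded solution of the homogeneous renewal equation the integral of `w` against the
stationary excess density is conserved. -/
lemma integral_intervalIntegral_sub_eq (ν : Measure I) [IsProbabilityMeasure ν] {w : ℝ → ℝ}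
    (hw : Measurable w) (hb : ∀ t, |w t| ≤ 1)
    (hrec : ∀ t, 0 ≤ t → w t = ∫ y : I, w (t - y) ∂ν) {t : ℝ} (ht : 0 ≤ t) :
    ∫ y : I, (∫ s in (0 : ℝ)..y, w (t - s)) ∂ν = ∫ y : I, (∫ s in (0 : ℝ)..y, w (-s)) ∂ν := by
  have hII := intervalIntegrable_of_abs_le_one hw hb
  have hcont : Continuous fun x => ∫ s in (0 : ℝ)..x, w s :=
    intervalIntegral.continuous_primitive (fun a b => hII a b) 0
  have hint : ∀ c : ℝ, Integrable (fun y : I => ∫ s in (0 : ℝ)..(c - y), w s) ν := fun c =>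
    Continuous.integrable_of_hasCompactSupport (hcont.comp (by fun_prop))
      (HasCompactSupport.of_compactSpace _)
  -- The renewal equation integrated over `[0, t]`, with Fubini; expressed through primitives of
  -- `w`, this is the conservation law.
  have hswap : ∫ s in (0 : ℝ)..t, w s = ∫ y : I, (∫ s in (0 : ℝ)..t, w (s - y)) ∂ν := by
    rw [← intervalIntegral_integral_swap]
    · refine intervalIntegral.integral_congr fun s hs => ?_
      rw [Set.uIcc_of_le ht] at hs
      exact hrec s hs.1
    · have : IsFiniteMeasure (volume.restrict (Set.uIoc 0 t)) :=
        ⟨by simp [Set.uIoc]⟩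
      exact integrable_of_abs_le_one (hw.comp (by fun_prop)) fun p => hb _
  have hΦ : ∀ c : ℝ, ∫ y : I, (∫ s in (0 : ℝ)..y, w (c - s)) ∂ν =
      (∫ s in (0 : ℝ)..c, w s) - ∫ y : I, (∫ s in (0 : ℝ)..(c - y), w s) ∂ν := by
    intro c
    have : ∀ y : I, (∫ s in (0 : ℝ)..y, w (c - s)) =
        (∫ s in (0 : ℝ)..c, w s) - ∫ s in (0 : ℝ)..(c - y), w s := by
      intro y
      rw [intervalIntegral.integral_comp_sub_left, sub_zero,
        intervalIntegral.integral_interval_sub_left (hII _ _) (hII _ _)]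
    simp_rw [this]
    rw [integral_sub (integrable_const _) (hint c)]
    simp
  have hshift : ∀ y : I, (∫ s in (0 : ℝ)..t, w (s - y)) =
      (∫ s in (0 : ℝ)..(t - y), w s) - ∫ s in (0 : ℝ)..(0 - y), w s := by
    intro y
    rw [intervalIntegral.integral_comp_sub_right,
      intervalIntegral.integral_interval_sub_left (hII _ _) (hII _ _)]
  simp_rw [hshift] at hswap
  rw [integral_sub (hint t) (hint 0)] at hswap
  have h0 := hΦ 0
  simp only [intervalIntegral.integral_same, zero_sub] at h0 hswap
  rw [hΦ t, h0, hswap]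
  ring

/-- The upper limit of a bounded solution of the homogeneous renewal equation is determined by the
conserved integral, provided that the solution is one-sidedly regular. -/
lemma mean_mul_limsup_eq (ν : Measure I) [IsProbabilityMeasure ν] [ν.IsOpenPosMeasure]
    {w : ℝ → ℝ} (hw : Measurable w) (hb : ∀ t, |w t| ≤ 1)
    (hrec : ∀ t, 0 ≤ t → w t = ∫ y : I, w (t - y) ∂ν) {Λ : ℝ}
    (hΛ : ∀ t, 0 ≤ t → ∫ y : I, (∫ s in (0 : ℝ)..y, w (t - s)) ∂ν = Λ)
    (hloc : ∀ ε > 0, ∀ y ∈ Set.Ioo (0 : ℝ) 1, ∃ V : Set I, IsOpen V ∧ V.Nonempty ∧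
      ∀ x ∈ V, ∀ t, w (t - x) ≤ w (t - y) + ε) :
    (∫ y : I, (y : ℝ) ∂ν) * limsup w atTop = Λ := by
  set M := limsup w atTop with hM
  have hbdd : IsBoundedUnder (· ≤ ·) atTop w :=
    isBoundedUnder_of ⟨1, fun t => (abs_le.1 (hb t)).2⟩
  have hcobdd : IsCoboundedUnder (· ≤ ·) atTop w :=
    IsBoundedUnder.isCoboundedUnder_le (isBoundedUnder_of ⟨-1, fun t => (abs_le.1 (hb t)).1⟩)
  have hex : ∀ n : ℕ, ∃ t : ℝ, (n : ℝ) ≤ t ∧ M - 1 / ((n : ℝ) + 1) < w t := by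
    intro n
    have hlt : M - 1 / ((n : ℝ) + 1) < limsup w atTop := by
      rw [← hM]
      have : 0 < 1 / ((n : ℝ) + 1) := by positivity
      linarith
    obtain ⟨t, h1, h2⟩ :=
      ((frequently_lt_of_lt_limsup hcobdd hlt).and_eventually (eventually_ge_atTop (n : ℝ))).exists
    exact ⟨t, h2, h1⟩
  choose τ hτ hwτ using hex
  have hτlim : Tendsto τ atTop atTop :=
    tendsto_atTop_mono hτ tendsto_natCast_atTop_atTop
  have hpt : ∀ y ∈ Set.Ioo (0 : ℝ) 1, Tendsto (fun n => w (τ n - y)) atTop (nhds M) := by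
    intro y hy
    refine tendsto_order.2 ⟨fun a ha => ?_, fun a ha => ?_⟩
    -- On `V`, of mass `p`, `w (τ n - x)` exceeds `w (τ n - y)` by at most `ε`; elsewhere it is
    -- below `M + p * ε`. Since `w (τ n) > M - p * ε`, averaging forces `K > -2 * ε`, so `w (τ n -
    -- y) > M - 3 * ε = a`.
    · set ε := (M - a) / 3 with hε
      have hεpos : 0 < ε := by rw [hε]; linarith
      obtain ⟨V, hVo, hVne, hV⟩ := hloc ε hεpos y hy
      set p := ν.real V with hp
      have hp0 : 0 < p := by
        rw [hp, measureReal_def]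
        exact ENNReal.toReal_pos (hVo.measure_pos ν hVne).ne' (measure_ne_top _ _)
      have hη : 0 < p * ε := by positivity
      have hup : ∀ᶠ s in atTop, w s < M + p * ε :=
        eventually_lt_of_limsup_lt (by rw [← hM]; linarith) hbdd
      obtain ⟨T, hT⟩ := eventually_atTop.1 hup
      have hsmall : ∀ᶠ n : ℕ in atTop, 1 / ((n : ℝ) + 1) < p * ε :=
        tendsto_one_div_add_atTop_nhds_zero_nat.eventually_lt_const hη
      filter_upwards [hsmall, hτlim.eventually_ge_atTop (T + 1), hτlim.eventually_ge_atTop 0]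
        with n h1 h2 h3
      set K := w (τ n - y) + ε - (M + p * ε) with hK
      have hle : w (τ n) ≤ M + p * ε + p * K := by
        rw [hrec _ h3]
        calc ∫ x : I, w (τ n - x) ∂ν
            ≤ ∫ x : I, (M + p * ε + V.indicator (fun _ => K) x) ∂ν := by
              refine integral_mono
                (integrable_of_abs_le_one (hw.comp (by fun_prop)) fun x => hb _)
                ((integrable_const _).add ((integrable_const _).indicator hVo.measurableSet))
                fun x => ?_
              by_cases hx : x ∈ V
              · have := hV x hx (τ n)
                simp only [hx, Set.indicator_of_mem, hK]
                linarith
              · have := hT (τ n - x) (by have := x.2.2; linarith)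
                simp only [hx, not_false_eq_true, Set.indicator_of_notMem]
                linarith
          _ = M + p * ε + p * K := by
              rw [integral_add (integrable_const _)
                ((integrable_const _).indicator hVo.measurableSet),
                integral_indicator_const _ hVo.measurableSet]
              simp [hp]
      have h4 := hwτ n
      have h5 : p * (-2 * ε) < p * K := by nlinarith
      have h6 := lt_of_mul_lt_mul_left h5 hp0.le
      rw [hK] at h6
      linarith
    · have h := eventually_lt_of_limsup_lt (f := atTop) (u := w) (by rw [← hM]; exact ha) hbdd
      exact (tendsto_atTop_add_const_right _ (-y) hτlim).eventually h
  have hinner : ∀ y : I, Tendsto (fun n => ∫ s in (0 : ℝ)..y, w (τ n - s)) atTop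
      (nhds ((y : ℝ) * M)) := by
    intro y
    have : (y : ℝ) * M = ∫ _ in (0 : ℝ)..y, M := by simp
    rw [this]
    refine intervalIntegral.tendsto_integral_filter_of_dominated_convergence (fun _ => 1)
      (Eventually.of_forall fun n => (hw.comp (by fun_prop)).aestronglyMeasurable)
      (Eventually.of_forall fun n => Eventually.of_forall fun s _ => by simpa using hb _)
      intervalIntegrable_const ?_
    filter_upwards [Measure.ae_ne volume (1 : ℝ)] with s hs hsy
    rw [Set.uIoc_of_le y.2.1] at hsy
    exact hpt s ⟨hsy.1, lt_of_le_of_ne (hsy.2.trans y.2.2) hs⟩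
  have hinnerbd : ∀ (y : I) t, ‖∫ s in (0 : ℝ)..y, w (t - s)‖ ≤ 1 := by
    intro y t
    refine (intervalIntegral.norm_integral_le_of_norm_le_const (C := 1)
      fun s _ => by simpa using hb _).trans ?_
    rw [sub_zero, abs_of_nonneg y.2.1, one_mul]
    exact y.2.2
  have hcontinner : ∀ t, Continuous fun y : I => ∫ s in (0 : ℝ)..y, w (t - s) := fun t =>
    (intervalIntegral.continuous_primitive (fun a b => intervalIntegrable_of_abs_le_one
      (hw.comp (measurable_const.sub measurable_id)) (fun s => hb _) a b) 0).comp
      continuous_subtype_val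
  have hlim : Tendsto (fun n => ∫ y : I, (∫ s in (0 : ℝ)..y, w (τ n - s)) ∂ν) atTop
      (nhds (∫ y : I, (y : ℝ) * M ∂ν)) :=
    tendsto_integral_of_dominated_convergence (fun _ => 1)
      (fun n => (hcontinner _).aestronglyMeasurable) (integrable_const _)
      (fun n => Eventually.of_forall fun y => hinnerbd y _)
      (Eventually.of_forall hinner)
  have hconst : Tendsto (fun n => ∫ y : I, (∫ s in (0 : ℝ)..y, w (τ n - s)) ∂ν) atTop
      (nhds Λ) :=
    tendsto_const_nhds.congr fun n => (hΛ _ ((Nat.cast_nonneg n).trans (hτ n))).symm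
  rw [← integral_mul_const]
  exact tendsto_nhds_unique hlim hconst

/-! ### Second order renewal theorem -/

/-- The second order renewal theorem for the renewal function `N` of a probability measure on
`[0,1]` of full support. -/
theorem tendsto_mean_mul_sub (ν : Measure I) [IsProbabilityMeasure ν] [ν.IsOpenPosMeasure]
    {N : ℝ → ℝ} (hmono : Monotone N) (hneg : ∀ t, t < 0 → N t = 0) {C : ℝ}
    (hgrowth : ∀ t, N t ≤ C * Real.exp t)
    (hrec : ∀ t, 0 ≤ t → N t = 1 + ∫ y : I, N (t - y) ∂ν) :
    Tendsto (fun t => (∫ y : I, (y : ℝ) ∂ν) * N t - t) atTop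
      (nhds ((∫ y : I, (y : ℝ) ^ 2 ∂ν) / 2 / ∫ y : I, (y : ℝ) ∂ν)) := by
  set μ := ∫ y : I, (y : ℝ) ∂ν with hμ
  have hμpos : 0 < μ := integral_coe_pos ν
  have hNint : ∀ t, Integrable (fun y : I => N (t - y)) ν := by
    intro t
    refine .of_bound (hmono.measurable.comp (by fun_prop)).aestronglyMeasurable
      (max |N (t - 1)| |N t|) (Eventually.of_forall fun y => ?_)
    exact abs_le_max_abs_abs (hmono (by have := y.2.2; linarith))
      (hmono (by have := y.2.1; linarith))
  have hyint : Integrable (fun y : I => (y : ℝ)) ν :=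
    Continuous.integrable_of_hasCompactSupport (by fun_prop) (HasCompactSupport.of_compactSpace _)
  have hN0 : ∀ t, 0 ≤ N t := fun t => by
    have h := hmono (min_le_left t (-1))
    rwa [hneg _ (by have := min_le_right t (-1); linarith)] at h
  have hC : 0 ≤ C := by
    have := (hN0 0).trans (hgrowth 0)
    simpa using this
  set r : ℝ → ℝ := fun t => μ * N t - t with hr
  have hrint : ∀ t, Integrable (fun y : I => r (t - y)) ν := fun t =>
    ((hNint t).const_mul μ).sub ((integrable_const t).sub hyint)
  have hrrec : ∀ t, 0 ≤ t → r t = ∫ y : I, r (t - y) ∂ν := by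
    intro t ht
    have h : ∫ y : I, r (t - y) ∂ν = ∫ y : I, μ * N (t - y) ∂ν - ∫ y : I, (t - y) ∂ν :=
      integral_sub ((hNint t).const_mul μ) ((integrable_const t).sub hyint)
    rw [h, integral_sub (integrable_const t) hyint, integral_const_mul, ← hμ]
    simp only [hr, hrec t ht, integral_const, probReal_univ, smul_eq_mul]
    ring
  have hrneg : ∀ t, t < 0 → r t = -t := fun t ht => by simp [hr, hneg t ht]
  have hexp : ∀ t : ℝ, t ≤ Real.exp t := fun t => by linarith [Real.add_one_le_exp t]
  have hr1 : ∀ t, -1 ≤ t → r t ≤ 1 := by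
    intro t ht
    have := nonpos_of_le_integral_sub ν (v := fun t => r t - 1) (C := μ * C) (by positivity)
      (fun t h1 h2 => by simp only [hrneg t h2]; linarith)
      (fun t ht => by
        have := mul_le_mul_of_nonneg_left (hgrowth t) hμpos.le
        simp only [hr]
        linarith)
      (fun t _ => (hrint t).sub (integrable_const _))
      (fun t ht => by
        rw [integral_sub (hrint t) (integrable_const _), ← hrrec t ht]
        simp) ht
    linarith
  have hr0 : ∀ t, -1 ≤ t → 0 ≤ r t := by
    intro t ht
    have := nonpos_of_le_integral_sub ν (v := fun t => -r t) (C := 1) zero_le_one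
      (fun t h1 h2 => by simp only [hrneg t h2]; linarith)
      (fun t ht => by
        have := mul_nonneg hμpos.le (hN0 t)
        have := hexp t
        simp only [hr]
        linarith)
      (fun t _ => (hrint t).neg)
      (fun t ht => by rw [integral_neg, ← hrrec t ht]) ht
    linarith
  -- `r t = -t` is unbounded at `-∞`. For `t ≥ 0` the equation sees only arguments `≥ -1`, so
  -- freezing `r` below `-1` costs nothing.
  set w : ℝ → ℝ := fun t => r (max t (-1)) with hw
  have hweq : ∀ t, -1 ≤ t → w t = r t := fun t ht => by simp [hw, ht]
  have hrm : Measurable r := (hmono.measurable.const_mul μ).sub measurable_id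
  have hwm : Measurable w := hrm.comp (measurable_id.max measurable_const)
  have hwb : ∀ t, |w t| ≤ 1 := fun t => abs_le.2
    ⟨by have := hr0 _ (le_max_right t (-1)); simp only [hw]; linarith, hr1 _ (le_max_right t (-1))⟩
  have hwrec : ∀ t, 0 ≤ t → w t = ∫ y : I, w (t - y) ∂ν := by
    intro t ht
    rw [hweq t (by linarith), hrrec t ht]
    congr 1 with y
    rw [hweq _ (by have := y.2.2; linarith)]
  -- Monotonicity of `N` is the only regularity available: `w` may jump up, but falls at most at
  -- unit rate. Hence the neighbourhoods `V` below lie to the right of `y` for `w` and to the left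
  -- for `-w`.
  have hlip : ∀ s t, s ≤ t → w s ≤ w t + (t - s) := by
    intro s t hst
    have h1 := mul_le_mul_of_nonneg_left (hmono (max_le_max_right (-1) hst)) hμpos.le
    have h2 : max t (-1) - max s (-1) ≤ t - s := by
      rcases max_cases t (-1) with h | h <;> rcases max_cases s (-1) with h' | h' <;> linarith
    simp only [hw, hr]
    linarith
  set Λ := (∫ y : I, (y : ℝ) ^ 2 ∂ν) / 2 with hΛdef
  have hΛ : ∀ t, 0 ≤ t → ∫ y : I, (∫ s in (0 : ℝ)..y, w (t - s)) ∂ν = Λ := by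
    intro t ht
    rw [integral_intervalIntegral_sub_eq ν hwm hwb hwrec ht, hΛdef, ← integral_div]
    congr 1 with y
    have : ∫ s in (0 : ℝ)..y, w (-s) = ∫ s in (0 : ℝ)..y, s := by
      -- Only almost everywhere: at `s = 0` the value is `w 0 = μ * N 0 > 0`.
      refine intervalIntegral.integral_congr_ae (Eventually.of_forall fun s hs => ?_)
      rw [Set.uIoc_of_le y.2.1] at hs
      rw [hweq _ (by have := y.2.2; linarith [hs.2]), hrneg _ (by linarith [hs.1]), neg_neg]
    rw [this, integral_id]
    ring
  have hup : μ * limsup w atTop = Λ := by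
    refine mean_mul_limsup_eq ν hwm hwb hwrec hΛ fun ε hε y hy => ?_
    refine ⟨{x : I | y < x ∧ (x : ℝ) < y + ε}, ?_, ?_, fun x hx t => ?_⟩
    · exact (isOpen_lt continuous_const continuous_subtype_val).inter
        (isOpen_lt continuous_subtype_val continuous_const)
    · obtain ⟨z, hz1, hz2⟩ := exists_between (lt_min hy.2 (lt_add_of_pos_right y hε))
      exact ⟨⟨z, by linarith [hy.1], (hz2.trans_le (min_le_left _ _)).le⟩, hz1,
        hz2.trans_le (min_le_right _ _)⟩
    · have := hlip (t - x) (t - y) (by linarith [hx.1])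
      linarith [hx.2]
  have hlow : μ * limsup (fun t => -w t) atTop = -Λ := by
    refine mean_mul_limsup_eq ν (w := fun t => -w t) hwm.neg (fun t => by simpa using hwb t)
      (fun t ht => by rw [integral_neg, ← hwrec t ht]) (fun t ht => ?_) fun ε hε y hy => ?_
    · simp_rw [intervalIntegral.integral_neg]
      rw [integral_neg, hΛ t ht]
    refine ⟨{x : I | y - ε < x ∧ (x : ℝ) < y}, ?_, ?_, fun x hx t => ?_⟩
    · exact (isOpen_lt continuous_const continuous_subtype_val).inter
        (isOpen_lt continuous_subtype_val continuous_const)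
    · obtain ⟨z, hz1, hz2⟩ := exists_between (max_lt hy.1 (sub_lt_self y hε))
      exact ⟨⟨z, ((le_max_left _ _).trans_lt hz1).le, by linarith [hy.2]⟩,
        (le_max_right _ _).trans_lt hz1, hz2⟩
    · have := hlip (t - y) (t - x) (by linarith [hx.2])
      linarith [hx.1]
  have hup' : limsup w atTop = Λ / μ := by rw [← hup]; field_simp
  have hlow' : limsup (fun t => -w t) atTop = -(Λ / μ) := by
    rw [← neg_div, ← hlow]; field_simp
  have hwlim : Tendsto w atTop (nhds (Λ / μ)) := by
    refine tendsto_order.2 ⟨fun a ha => ?_, fun a ha => ?_⟩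
    · have := eventually_lt_of_limsup_lt (f := atTop) (u := fun t => -w t) (b := -a)
        (by rw [hlow']; linarith) (isBoundedUnder_of ⟨1, fun t => neg_le.1 (abs_le.1 (hwb t)).1⟩)
      filter_upwards [this] with t ht
      linarith
    · exact eventually_lt_of_limsup_lt (by rw [hup']; exact ha)
        (isBoundedUnder_of ⟨1, fun t => (abs_le.1 (hwb t)).2⟩)
  refine hwlim.congr' ?_
  filter_upwards [eventually_ge_atTop 0] with t ht
  exact hweq t (by linarith)

/-! ### Lebesgue measure on the unit interval and the double integral -/

instance isOpenPosMeasure_unitInterval : (volume : Measure I).IsOpenPosMeasure := by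
  refine ⟨fun U hU hne => ?_⟩
  obtain ⟨O, hO, rfl⟩ := isOpen_induced_iff.1 hU
  obtain ⟨x, hx⟩ := hne
  rw [unitInterval.volume_apply]
  have hcl : (x : ℝ) ∈ closure (Set.Ioo (0 : ℝ) 1) := by
    rw [closure_Ioo zero_ne_one]
    exact x.2
  have hpos := (hO.inter isOpen_Ioo).measure_pos volume (mem_closure_iff.1 hcl O hO hx)
  refine (hpos.trans_le (measure_mono ?_)).ne'
  rintro z ⟨hz, hz'⟩
  exact ⟨⟨z, hz'.1.le, hz'.2.le⟩, hz, rfl⟩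

lemma integral_coe_unitInterval (g : ℝ → ℝ) :
    ∫ u : I, g u = ∫ u in (0 : ℝ)..1, g u := by
  rw [unitInterval.measurePreserving_coe.integral_comp unitInterval.measurableEmbedding_coe,
    integral_Icc_eq_integral_Ioc, intervalIntegral.integral_of_le zero_le_one]

/-- The inner integral is that of the positive part of `f x - u` over all `x`; after Fubini, `∫_0^1
max (a - u) 0 du = a²/2` for `a = f x`. -/
lemma overshootIntegral_eq (f : I ≃o I) :
    overshootIntegral f = (∫ x : I, (f x : ℝ) ^ 2) / 2 := by
  have hind : ∀ u : I, (∫ x in Set.Icc (f.symm u) 1, ((f x : ℝ) - (u : ℝ))) =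
      ∫ x : I, max ((f x : ℝ) - u) 0 := by
    intro u
    rw [← integral_indicator measurableSet_Icc]
    congr 1 with x
    by_cases h : x ∈ Set.Icc (f.symm u) 1
    · have h' : (u : ℝ) ≤ f x := (f.symm_apply_le).1 h.1
      rw [Set.indicator_of_mem h, max_eq_left (by linarith)]
    · have h' : f x < u := by
        by_contra hc
        exact h ⟨(f.symm_apply_le).2 (not_lt.1 hc), x.2.2⟩
      have h'' : (f x : ℝ) < u := h'
      rw [Set.indicator_of_notMem h, max_eq_right (by linarith)]
  have hfc : Continuous f := f.continuous
  unfold overshootIntegral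
  simp_rw [hind]
  rw [integral_integral_swap (Continuous.integrable_of_hasCompactSupport
    (by simp only [Function.uncurry_def]; fun_prop) (HasCompactSupport.of_compactSpace _)),
    ← integral_div]
  congr 1 with x
  rw [integral_coe_unitInterval fun u => max ((f x : ℝ) - u) 0]
  have hc : Continuous fun u : ℝ => max ((f x : ℝ) - u) 0 := by fun_prop
  rw [← intervalIntegral.integral_add_adjacent_intervals (b := (f x : ℝ))
    (hc.intervalIntegrable _ _) (hc.intervalIntegrable _ _)]
  have h1 : ∫ u in (0 : ℝ)..(f x), max ((f x : ℝ) - u) 0 =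
      ∫ u in (0 : ℝ)..(f x), ((f x : ℝ) - u) := by
    refine intervalIntegral.integral_congr fun u hu => ?_
    rw [Set.uIcc_of_le (f x).2.1] at hu
    exact max_eq_left (by linarith [hu.2])
  have h2 : ∫ u in (f x : ℝ)..1, max ((f x : ℝ) - u) 0 = ∫ u in (f x : ℝ)..1, (0 : ℝ) := by
    refine intervalIntegral.integral_congr fun u hu => ?_
    rw [Set.uIcc_of_le (f x).2.2] at hu
    exact max_eq_right (by linarith [hu.1])
  rw [h1, h2, intervalIntegral.integral_sub (by simp) (by simp)]
  simp
  ring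

/-! ### Renewal equation and finiteness for the expected passage index -/

section Passage

variable {Ω : Type*} (f : I ≃o I) (X : ℕ → Ω → I)

lemma monotone_partialSum (ω : Ω) : Monotone fun k => partialSum f X k ω :=
  monotone_nat_of_le_succ fun k => by
    simp only [partialSum, Finset.sum_range_succ]
    linarith [(f (X k ω)).2.1]

/-- The partial sums are nondecreasing, so the passage index counts the `k ≥ 0` with sum at most
`t`; if `t` is never exceeded, both sides are infinite. -/
lemma firstPassage_eq_tsum (t : ℝ) (ω : Ω) :
    (firstPassage f X t ω : ℝ≥0∞) =
      ∑' k : ℕ, {ω | partialSum f X k ω ≤ t}.indicator (fun _ => (1 : ℝ≥0∞)) ω := by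
  classical
  by_cases h : ∃ k, t < partialSum f X k ω
  · have hfp : firstPassage f X t ω = (Nat.find h : ℕ∞) :=
      le_antisymm (iInf₂_le (Nat.find h) (Nat.find_spec h))
        (le_iInf₂ fun k hk => by exact_mod_cast Nat.find_min' h hk)
    rw [hfp, tsum_eq_sum (s := Finset.range (Nat.find h))]
    · rw [Finset.sum_congr rfl fun k hk => Set.indicator_of_mem (s := {ω | partialSum f X k ω ≤ t})
        (not_lt.1 (Nat.find_min h (Finset.mem_range.1 hk))) _]
      simp
    · intro k hk
      rw [Finset.mem_range, not_lt] at hk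
      exact Set.indicator_of_notMem (s := {ω | partialSum f X k ω ≤ t})
        (not_le.2 ((Nat.find_spec h).trans_le (monotone_partialSum f X ω hk))) _
  · push Not at h
    have hfp : firstPassage f X t ω = ⊤ := by
      simp only [firstPassage, iInf_eq_top]
      exact fun k hk => absurd (h k) (not_le.2 hk)
    rw [hfp, tsum_congr fun k => Set.indicator_of_mem (s := {ω | partialSum f X k ω ≤ t}) (h k) _,
      ENNReal.tsum_const_eq_top_of_ne_zero one_ne_zero]
    rfl

variable [MeasurableSpace Ω] {P : Measure Ω} {f X}

lemma aemeasurable_partialSum (hX : ∀ i, AEMeasurable (X i) P) (k : ℕ) :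
    AEMeasurable (partialSum f X k) P := by
  unfold partialSum
  refine Finset.aemeasurable_fun_sum _ fun i _ => ?_
  exact (measurable_subtype_coe.comp f.continuous.measurable).comp_aemeasurable (hX i)

lemma expectedPassage_eq_tsum (hX : ∀ i, AEMeasurable (X i) P) (t : ℝ) :
    expectedPassage P f X t = ∑' k : ℕ, P {ω | partialSum f X k ω ≤ t} := by
  have hm : ∀ k, NullMeasurableSet {ω | partialSum f X k ω ≤ t} P := fun k =>
    (aemeasurable_partialSum hX k).nullMeasurableSet_preimage measurableSet_Iic
  simp_rw [expectedPassage, firstPassage_eq_tsum]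
  rw [lintegral_tsum fun k => (aemeasurable_const (b := (1 : ℝ≥0∞))).indicator₀ (hm k)]
  congr 1 with k
  rw [lintegral_indicator₀ (hm k)]
  simp

/-- Conditions on the last summand, which is independent of the preceding sum, so no shift of the
sequence is needed. -/
lemma measure_partialSum_succ_le [IsProbabilityMeasure P] (hindep : iIndepFun X P)
    (hunif : ∀ i, HasLaw (X i) (volume : Measure I) P) (k : ℕ) (t : ℝ) :
    P {ω | partialSum f X (k + 1) ω ≤ t} =
      ∫⁻ y : I, P {ω | partialSum f X k ω ≤ t - y} ∂((volume : Measure I).map f) := by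
  have hX : ∀ i, AEMeasurable (X i) P := fun i => (hunif i).aemeasurable
  have hfm : Measurable f := f.continuous.measurable
  have hcm : Measurable fun x : I => (f x : ℝ) := measurable_subtype_coe.comp hfm
  have hS := aemeasurable_partialSum (f := f) hX
  have hYm : AEMeasurable (fun ω => (f (X k ω) : ℝ)) P := hcm.comp_aemeasurable (hX k)
  have hind : IndepFun (partialSum f X k) (fun ω => (f (X k ω) : ℝ)) P := by
    have h := (hindep.comp (fun _ x => (f x : ℝ)) fun _ => hcm).indepFun_sum_range_succ₀
      (fun i => hcm.comp_aemeasurable (hX i)) k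
    convert h using 1
    · ext ω
      simp [partialSum, Finset.sum_apply]
    · rfl
  have hB : MeasurableSet {p : ℝ × ℝ | p.1 + p.2 ≤ t} :=
    measurableSet_le (measurable_fst.add measurable_snd) measurable_const
  have hlaw : P.map (fun ω => (f (X k ω) : ℝ)) =
      ((volume : Measure I).map f).map ((↑) : I → ℝ) := by
    rw [Measure.map_map measurable_subtype_coe hfm, ← (hunif k).map_eq,
      AEMeasurable.map_map_of_aemeasurable
        (measurable_subtype_coe.comp hfm).aemeasurable (hX k)]
    rfl
  have hmono : Antitone fun y : ℝ => P.map (partialSum f X k) (Set.Iic (t - y)) :=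
    fun a b hab => measure_mono (Set.Iic_subset_Iic.2 (by linarith))
  calc P {ω | partialSum f X (k + 1) ω ≤ t}
      = P.map (fun ω => (partialSum f X k ω, (f (X k ω) : ℝ))) {p | p.1 + p.2 ≤ t} := by
        rw [Measure.map_apply_of_aemeasurable ((hS k).prodMk hYm) hB]
        simp only [partialSum, Finset.sum_range_succ]
        rfl
    _ = ∫⁻ y : ℝ, P.map (partialSum f X k) (Set.Iic (t - y))
          ∂(P.map fun ω => (f (X k ω) : ℝ)) := by
        rw [hind.map_prod_eq_prod_map_map (hS k) hYm, Measure.prod_apply_symm hB]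
        congr 1 with y
        congr 1 with x
        simp [le_sub_iff_add_le]
    _ = ∫⁻ y : I, P {ω | partialSum f X k ω ≤ t - y} ∂((volume : Measure I).map f) := by
        rw [hlaw, lintegral_map hmono.measurable measurable_subtype_coe]
        congr 1 with y
        rw [Measure.map_apply_of_aemeasurable (hS k) measurableSet_Iic]
        rfl

/-- A Chernoff bound with parameter `1`; its geometric decay in `k` makes the expected passage index
finite. -/
lemma measure_partialSum_le_le [IsProbabilityMeasure P] (hindep : iIndepFun X P)
    (hunif : ∀ i, HasLaw (X i) (volume : Measure I) P) (k : ℕ) (t : ℝ) :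
    P {ω | partialSum f X k ω ≤ t} ≤ ENNReal.ofReal
      ((∫ y : I, Real.exp (-(y : ℝ)) ∂((volume : Measure I).map f)) ^ k * Real.exp t) := by
  set ν := (volume : Measure I).map f with hν
  have : IsProbabilityMeasure ν := Measure.isProbabilityMeasure_map f.continuous.aemeasurable
  set q := ∫ y : I, Real.exp (-(y : ℝ)) ∂ν with hq
  have hq0 : 0 ≤ q := integral_nonneg fun y => (Real.exp_pos _).le
  induction k generalizing t with
  | zero =>
    rcases lt_or_ge t 0 with h | h
    · have : {ω : Ω | partialSum f X 0 ω ≤ t} = ∅ := by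
        ext ω
        simpa [partialSum] using h
      simp [this]
    · refine prob_le_one.trans ?_
      simpa using h
  | succ k ih =>
    rw [measure_partialSum_succ_le hindep hunif]
    have hi : Integrable (fun y : I => q ^ k * Real.exp (t - y)) ν :=
      Continuous.integrable_of_hasCompactSupport (by fun_prop)
        (HasCompactSupport.of_compactSpace _)
    refine (lintegral_mono fun y : I => ih (t - y)).trans ?_
    rw [← ofReal_integral_eq_lintegral_ofReal hi
      (Eventually.of_forall fun y => by positivity)]
    refine ENNReal.ofReal_le_ofReal (le_of_eq ?_)
    simp_rw [sub_eq_add_neg t, Real.exp_add]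
    rw [integral_const_mul, integral_const_mul, ← hq]
    ring

lemma expectedPassage_le [IsProbabilityMeasure P] (hindep : iIndepFun X P)
    (hunif : ∀ i, HasLaw (X i) (volume : Measure I) P) :
    ∃ C : ℝ, ∀ t, expectedPassage P f X t ≤ ENNReal.ofReal (C * Real.exp t) := by
  have hν : IsProbabilityMeasure ((volume : Measure I).map f) :=
    Measure.isProbabilityMeasure_map f.continuous.aemeasurable
  have hν' : ((volume : Measure I).map f).IsOpenPosMeasure :=
    f.continuous.isOpenPosMeasure_map f.surjective
  set q := ∫ y : I, Real.exp (-(y : ℝ)) ∂((volume : Measure I).map f) with hq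
  have hq0 : 0 ≤ q := integral_nonneg fun y => (Real.exp_pos _).le
  have hq1 : q < 1 := integral_exp_neg_lt_one _
  refine ⟨(1 - q)⁻¹, fun t => ?_⟩
  rw [expectedPassage_eq_tsum fun i => (hunif i).aemeasurable]
  refine (ENNReal.tsum_le_tsum fun k => measure_partialSum_le_le hindep hunif k t).trans ?_
  rw [← ENNReal.ofReal_tsum_of_nonneg (fun k => by positivity)
    ((summable_geometric_of_lt_one hq0 hq1).mul_right _), tsum_mul_right,
    tsum_geometric_of_lt_one hq0 hq1]

lemma expectedPassage_eq_one_add [IsProbabilityMeasure P] (hindep : iIndepFun X P)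
    (hunif : ∀ i, HasLaw (X i) (volume : Measure I) P) {t : ℝ} (ht : 0 ≤ t) :
    expectedPassage P f X t =
      1 + ∫⁻ y : I, expectedPassage P f X (t - y) ∂((volume : Measure I).map f) := by
  have hX : ∀ i, AEMeasurable (X i) P := fun i => (hunif i).aemeasurable
  simp_rw [expectedPassage_eq_tsum hX]
  have hmono : ∀ k, Antitone fun y : ℝ => P {ω | partialSum f X k ω ≤ t - y} :=
    fun k a b hab => measure_mono <| Set.ofPred_subset_ofPred.2 fun ω hω => by linarith
  have hm : ∀ k, Measurable fun y : I => P {ω | partialSum f X k ω ≤ t - y} := fun k =>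
    (hmono k).measurable.comp measurable_subtype_coe
  -- The term `k = 0` is the summand `1`, the empty sum being at most `t` as `t ≥ 0`.
  rw [lintegral_tsum fun k => (hm k).aemeasurable, tsum_eq_zero_add' ENNReal.summable]
  congr 1
  · have : {ω : Ω | partialSum f X 0 ω ≤ t} = Set.univ := by
      ext ω
      simpa [partialSum] using ht
    rw [this, measure_univ]
  · exact tsum_congr fun k => measure_partialSum_succ_le hindep hunif k t

lemma expectedPassage_of_neg {t : ℝ} (ht : t < 0) : expectedPassage P f X t = 0 := by
  have : ∀ ω, firstPassage f X t ω = 0 := fun ω =>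
    le_antisymm (iInf₂_le (0 : ℕ) (by simpa [partialSum] using ht)) zero_le
  simp [expectedPassage, this]

lemma monotone_expectedPassage : Monotone (expectedPassage P f X) := fun s t hst =>
  lintegral_mono fun ω => by
    simp only [firstPassage_eq_tsum]
    refine ENNReal.tsum_le_tsum fun k => ?_
    exact Set.indicator_le_indicator_of_subset
      (Set.ofPred_subset_ofPred.2 fun ω hω => hω.trans hst) (fun _ => zero_le) ω

end Passage

/-- `f` is an increasing bijection of `[0,1]` (an order isomorphism), and the `X i` are independent
and uniformly distributed on `[0,1]`. -/
theorem theorem1 {Ω : Type*} [MeasurableSpace Ω] (P : Measure Ω) [IsProbabilityMeasure P]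
    (X : ℕ → Ω → I) (hindep : iIndepFun X P)
    (hunif : ∀ i, HasLaw (X i) (volume : Measure I) P)
    (f : I ≃o I) :
    (∀ i, ∫ ω, (f (X i ω) : ℝ) ∂P = meanValue P f X) ∧
    0 < meanValue P f X ∧
    (∀ t : ℝ, 0 ≤ t → expectedPassage P f X t ≠ ∞) ∧
    (fun t : ℝ => (expectedPassage P f X t).toReal
        - (t + overshootConst P f X) / meanValue P f X) =o[atTop] (fun _ => (1 : ℝ)) ∧
    (∀ i, overshootIntegral f = (∫ ω, (f (X i ω) : ℝ) ^ 2 ∂P) / 2) := by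
  have hfm : Measurable f := f.continuous.measurable
  have hcm : Measurable fun x : I => (f x : ℝ) := measurable_subtype_coe.comp hfm
  set ν := (volume : Measure I).map f with hνdef
  have hν : IsProbabilityMeasure ν := Measure.isProbabilityMeasure_map hfm.aemeasurable
  have hν' : ν.IsOpenPosMeasure := f.continuous.isOpenPosMeasure_map f.surjective
  have hmean : ∀ i, ∫ ω, (f (X i ω) : ℝ) ∂P = ∫ x : I, (f x : ℝ) := fun i =>
    (hunif i).integral_comp hcm.aestronglyMeasurable
  have hsq : ∀ i, ∫ ω, (f (X i ω) : ℝ) ^ 2 ∂P = ∫ x : I, (f x : ℝ) ^ 2 := fun i =>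
    (hunif i).integral_comp (f := fun x : I => (f x : ℝ) ^ 2) (hcm.pow_const 2).aestronglyMeasurable
  have hμν : ∫ y : I, (y : ℝ) ∂ν = meanValue P f X := by
    rw [meanValue, hmean, hνdef, integral_map hfm.aemeasurable
      measurable_subtype_coe.aestronglyMeasurable]
  have hsqν : ∫ y : I, (y : ℝ) ^ 2 ∂ν = ∫ x : I, (f x : ℝ) ^ 2 := by
    rw [hνdef, integral_map hfm.aemeasurable
      (measurable_subtype_coe.pow_const 2).aestronglyMeasurable]
  have hpos : 0 < meanValue P f X := hμν ▸ integral_coe_pos ν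
  obtain ⟨C, hC⟩ := expectedPassage_le (f := f) hindep hunif
  have hfin : ∀ t, expectedPassage P f X t ≠ ∞ := fun t =>
    ((hC t).trans_lt ENNReal.ofReal_lt_top).ne
  have hmono : Monotone fun t => (expectedPassage P f X t).toReal := fun s t hst =>
    ENNReal.toReal_mono (hfin t) (monotone_expectedPassage hst)
  -- A negative `C` would force the expected passage index at `0` to vanish, but it is at least `1`.
  have hC0 : 0 ≤ C := by
    by_contra! h
    have h0 := hC 0
    rw [ENNReal.ofReal_of_nonpos (by simpa using h.le),
      expectedPassage_eq_one_add hindep hunif le_rfl] at h0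
    simp at h0
  have hlim := tendsto_mean_mul_sub ν hmono
    (fun t ht => by simp [expectedPassage_of_neg ht]) (C := C)
    (fun t => ENNReal.toReal_le_of_le_ofReal (by positivity) (hC t))
    (fun t ht => by
      have hm : AEMeasurable (fun y : I => expectedPassage P f X (t - y)) ν :=
        (monotone_expectedPassage.measurable.comp
          (measurable_const.sub measurable_subtype_coe)).aemeasurable
      have h := expectedPassage_eq_one_add (f := f) hindep hunif ht
      rw [integral_toReal hm (Eventually.of_forall fun y => (hfin _).lt_top)]
      have hne : ∫⁻ y : I, expectedPassage P f X (t - y) ∂ν ≠ ∞ := fun htop =>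
        hfin t (by rw [h, htop, add_top])
      rw [h, ENNReal.toReal_add ENNReal.one_ne_top hne, ENNReal.toReal_one])
  refine ⟨fun i => by rw [meanValue, hmean, hmean], hpos, fun t _ => hfin t, ?_,
    fun i => by rw [overshootIntegral_eq, hsq]⟩
  rw [Asymptotics.isLittleO_one_iff]
  rw [hμν, hsqν, ← overshootIntegral_eq] at hlim
  have h := (hlim.sub_const (overshootConst P f X)).div_const (meanValue P f X)
  rw [overshootConst, sub_self, zero_div] at h
  refine h.congr fun t => ?_
  rw [overshootConst]
  field_simp
  ring
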